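/- For a point $P=(A,B)\in\mathcal P=\mathbb R^2\setminus\{O\}$ of the coefficient plane, where $O$ is the origin, let $L_P$ be the line $Ax+By=1$ in the Euclidean plane. Let $S\subset\mathcal P$ be finite, and let $\Delta$ be a bounded region (connected component) of the complement of $\bigcup_{P\in S}L_P$; it is a convex polygon. Let $P_k\in S$, $k\in\mathbb Z/n\mathbb Z$, be such that the lines $L_k=L_{P_k}$ are the lines that carry the $n$ sides of $\Delta$, each listed once, in the order in which they are met when the boundary of $\Delta$ is travelled clockwise. Let $D_k\in\{l,r\}$ be the side (left or right) of $L_k$ on which the origin of the Euclidean plane lies during this travel. A point $Q$ of the coefficient plane is to the right (left) of $P$ if it lies in the open half plane to the right (left) of the line directed from $O$ to $P$; to move right (left) along a line that does not contain $O$ is to move towards the points that are to the right (left) of a given point of that line. Fix $k$. Let $M$ be the line in the coefficient plane through $P_k$ parallel to $OP_{k+1}$ (it does not contain $O$ or $P_{k+1}$), and for $P\in M$ let $m(P)$ be the line through $P$ and $P_{k+1}$. Move $P$ along $M$, starting at $P_k$, in the direction given by $D_{k+1}$ (to the right if $D_{k+1}=r$, to the left if $D_{k+1}=l$). Then there is a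 first position $P^*\neq P_k$ at which $m(P)$ contains a point of $S$ that is not on the line $P_kP_{k+1}$. Let $Q_0,Q_1,\dots,Q_q$ be the points of $m(P^*)\cap S$, with $Q_0=P_{k+1}$, indexed in the order in which they appear on $m(P^*)$ when one starts at $Q_0$ and moves away from $P^*$, wrapping around to the opposite end of $m(P^*)$ if necessary and coming back towards $Q_0$ through $P^*$. Then $q\ge 1$, and $P_{k+2}=Q_q$ if $D_k=D_{k+1}$, while $P_{k+2}=Q_1$ if $D_k\neq D_{k+1}$. -/

import Mathlib

namespace LinePattern

/-- Both the coefficient plane and the Euclidean plane are modelled on `ℝ × ℝ`. Only the linear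
structure, the orientation and the topology of the plane are used. -/
abbrev Plane := ℝ × ℝ

/-- The line `A x + B y = 1` in the Euclidean plane with coefficient point `P = (A, B)`. -/
def coeffLine (P : Plane) : Set Plane := {X | P.1 * X.1 + P.2 * X.2 = 1}

/-- A region (cell) of the pattern of lines `coeffLine P`, `P ∈ S`: a connected component of the
complement of their union. -/
def IsRegion (S Δ : Set Plane) : Prop :=
  ∃ x ∈ (⋃ P ∈ S, coeffLine P)ᶜ, Δ = connectedComponentIn (⋃ P ∈ S, coeffLine P)ᶜ x

/-- The oriented area of the parallelogram spanned by `u` and `v`. It is positive when `v` points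
to the left of the direction `u`, and negative when `v` points to the right of it. -/
def cross (u v : Plane) : ℝ := u.1 * v.2 - u.2 * v.1

/-- The two values "left" and "right". -/
inductive Side
  | l
  | r

/-- `LiesOn d u v`: the vector `v` points to the side `d` of the direction `u`. For points `P`, `Q`
of the coefficient plane, `LiesOn .r P Q` says that `Q` is to the right of `P`, that is, in the open
half plane to the right of the line directed from the origin to `P`. -/
def LiesOn : Side → Plane → Plane → Prop
  | .l, u, v => 0 < cross u v
  | .r, u, v => cross u v < 0

/-- `P k`, for `k` modulo `n`, are the coefficient points of the lines that carry the sides of the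
region `Δ`, each listed once, in the order met when the boundary of `Δ` is travelled clockwise;
the `k`-th side is travelled from the vertex `V k` to the vertex `V (k + 1)`. -/
structure IsClockwiseTour (S Δ : Set Plane) {n : ℕ} (P V : ZMod n → Plane) : Prop where
  mem : ∀ k, P k ∈ S
  injective : Function.Injective P
  vertex_ne : ∀ k, V k ≠ V (k + 1)
  /-- the side of `Δ` on the line of `P k` is the segment from `V k` to `V (k + 1)` -/
  side_eq : ∀ k, closure Δ ∩ coeffLine (P k) = segment ℝ (V k) (V (k + 1))
  /-- clockwise travel: `Δ` is to the right of each side in its direction of travel -/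
  clockwise : ∀ k, ∀ x ∈ Δ, LiesOn .r (V (k + 1) - V k) (x - V k)
  /-- the sides make up the whole boundary -/
  frontier_eq : frontier Δ = ⋃ k, segment ℝ (V k) (V (k + 1))

/-- The side on which the origin sits when one travels from `V k` to `V (k + 1)`. (When the line
travelled on does not contain the origin, the cross product is not zero.) -/
noncomputable def originSide {n : ℕ} (V : ZMod n → Plane) (k : ZMod n) : Side :=
  if cross (V (k + 1) - V k) (0 - V k) < 0 then .r else .l

/-- The line `M` through `A` that is parallel to the line through the origin and `B`. -/
def parallelLine (A B : Plane) : Set Plane := {Y | ∃ s : ℝ, Y = A + s • B}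

/-- The line `m(Y)` of the pencil through `B`: the line that joins `Y` and `B`. -/
noncomputable def pencilLine (B Y : Plane) : AffineSubspace ℝ Plane := affineSpan ℝ {Y, B}

/-- `T` is the position at which a point `Y`, which starts at `A` and moves along `parallelLine A B`
in the direction `d`, stops: the line `pencilLine B Y`, rotating about `B`, contains there
for the first time a point of `S` that is not on the line through `A` and `B`. -/
structure IsFirstHit (S : Set Plane) (A B : Plane) (d : Side) (T : Plane) : Prop where
  mem : T ∈ parallelLine A B
  direction : LiesOn d A T
  hit : ∃ X ∈ S, X ∈ pencilLine B T ∧ X ∉ pencilLine B A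
  first : ∀ Y, Sbtw ℝ A Y T → ∀ X ∈ S, X ∈ pencilLine B Y → X ∈ pencilLine B A

/-- Travel on the line through `B` and `T` starts at `B`, goes away from `T`, and returns to `B`
from the opposite end of the line, so that the parameter `t` of `B + t • (B - T)` runs first
from `0` to `∞` and then from `-∞` to `0`. `MetBefore B T X Y` says that the point `X`
of the line is met before the point `Y`. -/
def MetBefore (B T X Y : Plane) : Prop :=
  ∃ s t : ℝ, X = B + s • (B - T) ∧ Y = B + t • (B - T) ∧
    ((0 ≤ s ∧ s < t) ∨ (0 ≤ s ∧ t < 0) ∨ (s < t ∧ t < 0))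

/-- `Q 0 = B, Q 1, …, Q q` are the points of `S` on the line through `B` and `T`, listed in
the order in which they are met in the sense of `MetBefore`. -/
structure IsTravelList (S : Set Plane) (B T : Plane) {q : ℕ} (Q : Fin (q + 1) → Plane) :
    Prop where
  start : Q 0 = B
  range_eq : Set.range Q = (pencilLine B T : Set Plane) ∩ S
  ordered : ∀ i j, i < j → MetBefore B T (Q i) (Q j)

end LinePattern

namespace LinePattern

/-! The proof is point-line duality. Write A, B, C for `P k`, `P (k + 1)`, `P (k + 2)`, and b, a for
the ends of the side on the line of B. A line through B avoiding the origin consists of the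
coefficient points of the lines through one point Z of the line of B (`mem_pencilLine_iff_pair`). As
the moving point leaves A, its Z leaves b and runs along the side. No line of the pattern separates
two points of the closed region, so nothing new is met before Z = a, where C is met
(`isFirstHit_iff`).

The hit line is thus the set of lines through a. Let d be the far end of the side on the line of C.
No pattern line through a separates b from d, which makes C a neighbour of B in the cyclic order of
the pattern points on the hit line (`mul_nonneg_of_pair`). Whether it is the first or the last one
met depends on the sign of `cross A B`, which the two origin sides determine
(`cross_mul_cross_mul_cross_neg`). -/

/-! ### Duality between points and lines -/

/-- The pairing of the coefficient plane with the Euclidean plane. -/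
def pair (P X : Plane) : ℝ := P.1 * X.1 + P.2 * X.2

theorem mem_coeffLine {P X : Plane} : X ∈ coeffLine P ↔ pair P X = 1 := Iff.rfl

/-- Multiplicativity of the 2 × 2 determinant; it carries orientation from one plane to the other.
-/
theorem pair_mul_pair_sub (P Q X Y : Plane) :
    cross P Q * cross X Y = pair P X * pair Q Y - pair P Y * pair Q X := by
  simp only [cross, pair]; ring

theorem continuous_pair (P : Plane) : Continuous (pair P) := by
  unfold pair; fun_prop

theorem continuous_cross (u : Plane) : Continuous (cross u) := by
  unfold cross; fun_prop

/-- A coefficient point is determined by two points of its line. -/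
theorem eq_of_pair_eq_one {P Q X Y : Plane} (hXY : X ≠ Y) (hPX : pair P X = 1)
    (hPY : pair P Y = 1) (hQX : pair Q X = 1) (hQY : pair Q Y = 1) : P = Q := by
  by_cases h : cross X Y = 0
  · refine absurd ?_ hXY
    simp only [pair, cross] at *
    ext
    · linear_combination Y.1 * hPX - X.1 * hPY + P.2 * h
    · linear_combination Y.2 * hPX - X.2 * hPY - P.1 * h
  · simp only [pair, cross] at *
    ext
    · apply mul_right_cancel₀ h
      linear_combination Y.2 * (hPX - hQX) - X.2 * (hPY - hQY)
    · apply mul_right_cancel₀ h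
      linear_combination X.1 * (hPY - hQY) - Y.1 * (hPX - hQX)

/-- Two distinct lines that meet are not parallel. -/
theorem cross_ne_zero_of_pair_eq_one {P Q X : Plane} (hPQ : P ≠ Q) (hP : pair P X = 1)
    (hQ : pair Q X = 1) : cross P Q ≠ 0 := by
  intro h
  apply hPQ
  simp only [pair, cross] at *
  ext
  · linear_combination Q.1 * hP - P.1 * hQ + X.2 * h
  · linear_combination Q.2 * hP - P.2 * hQ - X.1 * h

theorem cross_ne_zero_of_pair_eq_one' {P X Y : Plane} (hXY : X ≠ Y) (hX : pair P X = 1)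
    (hY : pair P Y = 1) : cross X Y ≠ 0 := by
  refine cross_ne_zero_of_pair_eq_one (X := P) hXY ?_ ?_ <;> simp only [pair] at * <;> linarith

theorem mem_pencilLine {B Y X : Plane} :
    X ∈ pencilLine B Y ↔ ∃ t : ℝ, X = B + t • (B - Y) := by
  rw [pencilLine, mem_affineSpan_pair_iff_exists_lineMap_rev_eq]
  constructor
  · rintro ⟨r, rfl⟩
    refine ⟨-r, ?_⟩
    simp only [AffineMap.lineMap_apply, vsub_eq_sub, vadd_eq_add]
    module
  · rintro ⟨t, rfl⟩
    refine ⟨-t, ?_⟩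
    simp only [AffineMap.lineMap_apply, vsub_eq_sub, vadd_eq_add]
    module

/-- If the lines of `B ≠ Y` meet in `Z`, then the points of the pencil line of `B` and `Y` are the
coefficient points of the lines through `Z`. -/
theorem mem_pencilLine_iff_pair {B Y Z : Plane} (hBY : B ≠ Y) (hB : pair B Z = 1)
    (hY : pair Y Z = 1) (X : Plane) : X ∈ pencilLine B Y ↔ pair X Z = 1 := by
  rw [mem_pencilLine]
  constructor
  · rintro ⟨t, rfl⟩
    simp only [pair, Prod.fst_add, Prod.snd_add, Prod.smul_fst, Prod.smul_snd, Prod.fst_sub,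
      Prod.snd_sub, smul_eq_mul] at *
    linear_combination (1 + t) * hB - t * hY
  · intro hX
    have h0 : cross B Y ≠ 0 := cross_ne_zero_of_pair_eq_one hBY hB hY
    have hcol : cross (X - B) (B - Y) = 0 := by
      simp only [pair, cross, Prod.fst_sub, Prod.snd_sub] at *
      linear_combination (B.1 * (B.2 - Y.2) - B.2 * (B.1 - Y.1)) * (hX - hB)
        + (B.2 * (X.1 - B.1) - B.1 * (X.2 - B.2)) * (hB - hY)
        - ((X.1 - B.1) * (B.2 - Y.2) - (X.2 - B.2) * (B.1 - Y.1)) * hB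
    -- Cramer's rule: apply `cross · B` to X = B + t (B - Y) and solve for t.
    refine ⟨cross X B / cross B Y, ?_⟩
    rw [← sub_eq_zero]
    apply (smul_eq_zero.1 _).resolve_left h0
    rw [smul_sub, smul_add, smul_smul, mul_div_cancel₀ _ h0]
    simp only [cross, Prod.fst_sub, Prod.snd_sub] at *
    ext <;> simp only [Prod.fst_add, Prod.snd_add, Prod.smul_fst, Prod.smul_snd, Prod.fst_sub,
        Prod.snd_sub, smul_eq_mul, Prod.fst_zero, Prod.snd_zero]
    · linear_combination (-B.1) * hcol
    · linear_combination (-B.2) * hcol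

/-! ### Regions are not cut by the pattern -/

/-- The closure of a region lies on one side of each line of the pattern. -/
theorem IsRegion.pair_sub_one_mul_nonneg {S Δ : Set Plane} (hΔ : IsRegion S Δ) {Q : Plane}
    (hQ : Q ∈ S) {x y : Plane} (hx : x ∈ closure Δ) (hy : y ∈ closure Δ) :
    0 ≤ (pair Q x - 1) * (pair Q y - 1) := by
  obtain ⟨z, -, rfl⟩ := hΔ
  set Δ := connectedComponentIn (⋃ P ∈ S, coeffLine P)ᶜ z with hΔ
  have hne : ∀ x ∈ Δ, pair Q x - 1 ≠ 0 := by
    intro x hx h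
    refine connectedComponentIn_subset _ _ hx (Set.mem_biUnion hQ ?_)
    exact mem_coeffLine.2 (by linarith)
  have hc : Continuous fun x => pair Q x - 1 := (continuous_pair Q).sub continuous_const
  have hpos : ∀ p ∈ Δ ×ˢ Δ, 0 ≤ (pair Q p.1 - 1) * (pair Q p.2 - 1) := by
    rintro ⟨x, y⟩ ⟨hx, hy⟩
    by_contra! hlt
    have himg := (isPreconnected_connectedComponentIn.image (s := Δ) _ hc.continuousOn).ordConnected
    have h0 : (0 : ℝ) ∈ (fun x => pair Q x - 1) '' Δ := by
      rcases mul_neg_iff.1 hlt with h | h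
      · exact himg.out (Set.mem_image_of_mem _ hy) (Set.mem_image_of_mem _ hx) ⟨h.2.le, h.1.le⟩
      · exact himg.out (Set.mem_image_of_mem _ hx) (Set.mem_image_of_mem _ hy) ⟨h.1.le, h.2.le⟩
    obtain ⟨w, hw, h⟩ := h0
    exact hne w hw h
  have hcl : IsClosed {p : Plane × Plane | 0 ≤ (pair Q p.1 - 1) * (pair Q p.2 - 1)} :=
    isClosed_le continuous_const ((hc.comp continuous_fst).mul (hc.comp continuous_snd))
  have hmem : (x, y) ∈ closure (Δ ×ˢ Δ) := by rw [closure_prod_eq]; exact ⟨hx, hy⟩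
  exact closure_minimal hpos hcl hmem

theorem add_smul_sub_injective {B T : Plane} (hBT : B ≠ T) :
    Function.Injective fun t : ℝ => B + t • (B - T) :=
  (add_right_injective B).comp (smul_left_injective ℝ (sub_ne_zero.2 hBT))

/-! ### Existence of the travel list -/

/-- The points of a finite set on a line can be listed in the order of travel. -/
theorem exists_isTravelList {S : Set Plane} (hS : S.Finite) {B T : Plane} (hB : B ∈ S)
    (hBT : B ≠ T) : ∃ (q : ℕ) (Q : Fin (q + 1) → Plane), IsTravelList S B T Q := by
  classical
  have hfin : {t : ℝ | B + t • (B - T) ∈ S}.Finite :=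
    hS.preimage (add_smul_sub_injective hBT).injOn
  -- Since `false < true`, the lexicographic order puts parameters `t ≥ 0` before `t < 0`, each
  -- group increasing; `key 0` is the least key.
  let key : ℝ → Bool ×ₗ ℝ := fun t => toLex (decide (t < 0), t)
  let K := hfin.toFinset.image key
  have hmemK : ∀ z, z ∈ K ↔ ∃ t, B + t • (B - T) ∈ S ∧ key t = z := by
    intro z; simp [K]
  have h0K : key 0 ∈ K := (hmemK _).2 ⟨0, by simpa using hB, rfl⟩
  have hcard : K.card = (K.card - 1) + 1 := by
    have := Finset.card_pos.2 ⟨_, h0K⟩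
    omega
  generalize K.card - 1 = q at hcard
  let e := K.orderEmbOfFin hcard
  have he : ∀ i, ∃ t, B + t • (B - T) ∈ S ∧ key t = e i :=
    fun i => (hmemK _).1 (K.orderEmbOfFin_mem hcard i)
  choose τ hτS hτ using he
  refine ⟨q, fun i => B + τ i • (B - T), ?_, ?_, ?_⟩
  · obtain ⟨i, hi⟩ : key 0 ∈ Set.range e := by
      rw [Finset.range_orderEmbOfFin]; exact h0K
    have h1 : e 0 ≤ key 0 := hi ▸ e.monotone (Fin.zero_le i)
    rw [← hτ 0, Prod.Lex.toLex_le_toLex] at h1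
    have h2 : τ 0 = 0 := by
      rcases h1 with h1 | ⟨h1, h2⟩
      · exact absurd h1 (by simp [Bool.lt_iff])
      · simp only [lt_irrefl, decide_false, decide_eq_false_iff_not, not_lt] at h1
        exact le_antisymm h2 h1
    simp [h2]
  · ext X
    simp only [Set.mem_range, Set.mem_inter_iff, SetLike.mem_coe, mem_pencilLine]
    constructor
    · rintro ⟨i, rfl⟩
      exact ⟨⟨_, rfl⟩, hτS i⟩
    · rintro ⟨⟨t, rfl⟩, hX⟩
      obtain ⟨i, hi⟩ : key t ∈ Set.range e := by
        rw [Finset.range_orderEmbOfFin]; exact (hmemK _).2 ⟨t, hX, rfl⟩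
      refine ⟨i, ?_⟩
      rw [← hτ i] at hi
      have : τ i = t := congrArg (fun z => (ofLex z).2) hi
      rw [this]
  · intro i j hij
    have h : e i < e j := e.strictMono hij
    rw [← hτ i, ← hτ j, Prod.Lex.toLex_lt_toLex] at h
    refine ⟨τ i, τ j, rfl, rfl, ?_⟩
    by_cases hi : τ i < 0 <;> by_cases hj : τ j < 0 <;> simp only [hi, hj] at h
    · exact Or.inr (Or.inr ⟨by simpa using h, hj⟩)
    · exact absurd h (by simp [Bool.lt_iff])
    · exact Or.inr (Or.inl ⟨not_lt.1 hi, hj⟩)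
    · exact Or.inl ⟨not_lt.1 hi, by simpa using h⟩

/-! ### Sign and pairing identities -/

theorem liesOn_ite_iff {x : ℝ} (hx : x ≠ 0) (u v : Plane) :
    LiesOn (if x < 0 then .r else .l) u v ↔ 0 < cross u v * x := by
  rcases lt_or_gt_of_ne hx with h | h
  · rw [if_pos h, ← neg_mul_neg, mul_pos_iff_of_pos_right (neg_pos.2 h), neg_pos, LiesOn]
  · rw [if_neg (not_lt.2 h.le), mul_pos_iff_of_pos_right h, LiesOn]

theorem cross_sub_neg (X Y : Plane) : cross (Y - X) (0 - X) = cross X Y := by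
  simp only [cross, Prod.fst_sub, Prod.snd_sub, Prod.fst_zero, Prod.snd_zero]; ring

/-- The line of `B`, which carries `X` and `Y`, seen as a line directed from `X` to `Y`. -/
theorem cross_sub_sub_of_pair_eq_one {B X Y : Plane} (hX : pair B X = 1) (hY : pair B Y = 1)
    (Z : Plane) : cross (Y - X) (Z - X) = -((pair B Z - 1) * cross X Y) := by
  simp only [cross, pair, Prod.fst_sub, Prod.snd_sub] at *
  linear_combination (Z.1 * Y.2 - Z.2 * Y.1) * hX + (Z.2 * X.1 - Z.1 * X.2) * hY

theorem pair_add_smul (P Q : Plane) (t : ℝ) (X : Plane) :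
    pair (P + t • Q) X = pair P X + t * pair Q X := by
  simp only [pair, Prod.fst_add, Prod.snd_add, Prod.smul_fst, Prod.smul_snd, smul_eq_mul]; ring

theorem pair_sub (P Q X : Plane) : pair (P - Q) X = pair P X - pair Q X := by
  simp only [pair, Prod.fst_sub, Prod.snd_sub]; ring

theorem pair_add_smul_sub (P : Plane) (t : ℝ) (X Y : Plane) :
    pair P (X + t • (Y - X)) = (1 - t) * pair P X + t * pair P Y := by
  simp only [pair, Prod.fst_add, Prod.snd_add, Prod.smul_fst, Prod.smul_snd, smul_eq_mul,
    Prod.fst_sub, Prod.snd_sub]; ring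

theorem cross_add_smul_self (A B : Plane) (s : ℝ) : cross A (A + s • B) = s * cross A B := by
  simp only [cross, Prod.fst_add, Prod.snd_add, Prod.smul_fst, Prod.smul_snd, smul_eq_mul]; ring

theorem ne_add_smul {A B : Plane} (h : cross A B ≠ 0) (s : ℝ) : B ≠ A + s • B := by
  intro h'
  apply h
  have h1 := congrArg Prod.fst h'
  have h2 := congrArg Prod.snd h'
  simp only [cross, Prod.fst_add, Prod.snd_add, Prod.smul_fst, Prod.smul_snd, smul_eq_mul] at *
  linear_combination B.1 * h2 - B.2 * h1

/-! ### The first hit -/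

/-- Consecutive sides: `b` and `a` are the ends of a side on the line of `B`, the line of `A` passes
through `b`, and the line of `C` passes through `a`. The line that turns about `B` reaches the
end `a` of the side at the point `A + (cross A B * cross b a) • B`, and stops there. -/
theorem isFirstHit_iff {S : Set Plane} {A B C a b T : Plane} (hab : b ≠ a) (hAB : A ≠ B)
    (hCB : C ≠ B) (hC : C ∈ S) (hAb : pair A b = 1) (hBb : pair B b = 1) (hBa : pair B a = 1)
    (hCa : pair C a = 1) (hside : ∀ Q ∈ S, 0 ≤ (pair Q b - 1) * (pair Q a - 1)) :
    IsFirstHit S A B (if cross b a < 0 then .r else .l) T ↔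
      T = A + (cross A B * cross b a) • B := by
  have hx : cross A B ≠ 0 := cross_ne_zero_of_pair_eq_one hAB hAb hBb
  have hy : cross b a ≠ 0 := cross_ne_zero_of_pair_eq_one' hab hBb hBa
  set σ := cross A B * cross b a with hσ
  have hσ0 : σ ≠ 0 := mul_ne_zero hx hy
  have hAa : pair A a = 1 - σ := by
    have := pair_mul_pair_sub A B b a
    rw [hAb, hBb, hBa] at this
    linarith
  have hBA : ∀ X, X ∈ pencilLine B A ↔ pair X b = 1 :=
    mem_pencilLine_iff_pair hAB.symm hBb hAb
  -- The dictionary: the lines of B and A + (r σ) B meet at b + r (a - b), so r = 1 corresponds to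
  -- the end a.
  have hpen : ∀ r X, X ∈ pencilLine B (A + (r * σ) • B) ↔ pair X (b + r • (a - b)) = 1 := by
    intro r
    refine mem_pencilLine_iff_pair (ne_add_smul hx _) ?_ ?_
    · rw [pair_add_smul_sub, hBb, hBa]; ring
    · rw [pair_add_smul, pair_add_smul_sub, pair_add_smul_sub, hBb, hBa, hAb, hAa]; ring
  have hstart : ∀ X ∈ S, ∀ r, 0 < r → r < 1 → X ∈ pencilLine B (A + (r * σ) • B) →
      X ∈ pencilLine B A := by
    intro X hX r h0 h1 h
    rw [hpen, pair_add_smul_sub] at h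
    rw [hBA]
    -- A proper convex combination of two numbers that are not of opposite sign vanishes only if
    -- both do.
    have h2 := hside X hX
    have h3 : r * (pair X a - 1) = -((1 - r) * (pair X b - 1)) := by linarith
    have h4 : r * ((pair X b - 1) * (pair X a - 1)) = -((1 - r) * (pair X b - 1) ^ 2) := by
      linear_combination (pair X b - 1) * h3
    have h5 : (1 - r) * (pair X b - 1) ^ 2 ≤ 0 := by nlinarith [mul_nonneg h0.le h2]
    have h6 : (pair X b - 1) ^ 2 = 0 :=
      le_antisymm (nonpos_of_mul_nonpos_right h5 (by linarith)) (sq_nonneg _)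
    linarith [pow_eq_zero_iff (two_ne_zero) |>.1 h6]
  have hhit : C ∈ pencilLine B (A + σ • B) := by
    have := hpen 1 C
    rw [one_mul] at this
    rw [this, pair_add_smul_sub, hCa]; ring
  have hnhit : C ∉ pencilLine B A := by
    rw [hBA]
    exact fun h => hCB (eq_of_pair_eq_one hab h hCa hBb hBa)
  have hBne : B ≠ 0 := by rintro rfl; simp [pair] at hBb
  have hsbtw : ∀ r s : ℝ, s ≠ 0 → 0 < r → r < 1 → Sbtw ℝ A (A + (r * s) • B) (A + s • B) := by
    intro r s hs h0 h1
    have : A + (r * s) • B = AffineMap.lineMap A (A + s • B) r := by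
      simp only [AffineMap.lineMap_apply, vsub_eq_sub, vadd_eq_add]; module
    rw [this, sbtw_lineMap_iff]
    refine ⟨fun h => ?_, h0, h1⟩
    exact smul_ne_zero hs hBne (left_eq_add.1 h)
  constructor
  · intro h
    obtain ⟨s, rfl⟩ := h.mem
    have hd := h.direction
    rw [liesOn_ite_iff hy, cross_add_smul_self, mul_assoc, ← hσ] at hd
    -- The prescribed direction gives s the sign of σ, so the motion is towards a.
    have hρ : 0 < s / σ := by
      rw [← mul_div_mul_right s σ hσ0]
      exact div_pos hd (mul_self_pos.2 hσ0)
    have hs0 : s ≠ 0 := by rintro rfl; simp at hd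
    have hs : s / σ * σ = s := div_mul_cancel₀ s hσ0
    rcases lt_trichotomy (s / σ) 1 with h1 | h1 | h1
    · obtain ⟨X, hX, hX1, hX2⟩ := h.hit
      rw [← hs] at hX1
      exact absurd (hstart X hX _ hρ h1 hX1) hX2
    · rw [h1, one_mul] at hs
      rw [hs]
    -- A later stop would have passed A + σ B, where C is already hit.
    · have h2 : (s / σ)⁻¹ * s = σ := by field_simp
      have h3 := hsbtw (s / σ)⁻¹ s hs0 (inv_pos.2 hρ) (inv_lt_one_of_one_lt₀ h1)
      rw [h2] at h3
      exact absurd (h.first _ h3 C hC hhit) hnhit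
  · rintro rfl
    refine ⟨⟨_, rfl⟩, ?_, ⟨C, hC, hhit, hnhit⟩, ?_⟩
    · rw [liesOn_ite_iff hy, cross_add_smul_self, mul_assoc, ← hσ]
      exact mul_self_pos.2 hσ0
    · intro Y hY X hX
      obtain ⟨r, ⟨h0, h1⟩, rfl⟩ := hY.mem_image_Ioo
      have : AffineMap.lineMap A (A + σ • B) r = A + (r * σ) • B := by
        simp only [AffineMap.lineMap_apply, vsub_eq_sub, vadd_eq_add]; module
      rw [this]
      exact hstart X hX r h0 h1

/-! ### The place of the next side in the travel list -/

theorem IsTravelList.eq_last {S : Set Plane} {B T C : Plane} {q : ℕ} {Q : Fin (q + 1) → Plane}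
    (hQ : IsTravelList S B T Q) (hC : C ∈ Set.range Q) (hlast : ∀ X ∈ S, ¬ MetBefore B T C X) :
    C = Q (Fin.last q) := by
  obtain ⟨i, rfl⟩ := hC
  rcases (Fin.le_last i).eq_or_lt with h | h
  · rw [h]
  · have hS : Q (Fin.last q) ∈ S := (hQ.range_eq.subset ⟨_, rfl⟩).2
    exact absurd (hQ.ordered _ _ h) (hlast _ hS)

theorem IsTravelList.pos {S : Set Plane} {B T C : Plane} {q : ℕ} {Q : Fin (q + 1) → Plane}
    (hQ : IsTravelList S B T Q) (hC : C ∈ Set.range Q) (hCB : C ≠ B) : 0 < q := by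
  obtain ⟨i, rfl⟩ := hC
  rcases q.eq_zero_or_pos with rfl | h
  · rw [show i = 0 from Subsingleton.elim (α := Fin 1) i 0] at hCB
    exact absurd hQ.start hCB
  · exact h

theorem IsTravelList.eq_one {S : Set Plane} {B T C : Plane} {q : ℕ} {Q : Fin (q + 1) → Plane}
    (hQ : IsTravelList S B T Q) (hC : C ∈ Set.range Q) (hCB : C ≠ B)
    (hfirst : ∀ X ∈ S, MetBefore B T B X → ¬ MetBefore B T X C) : C = Q 1 := by
  -- For q = 0 the index `1 : Fin (q + 1)` would wrap around to 0.
  obtain ⟨m, rfl⟩ : ∃ m, q = m + 1 := ⟨q - 1, by have := hQ.pos hC hCB; omega⟩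
  obtain ⟨i, rfl⟩ := hC
  have hi : i ≠ 0 := by rintro rfl; exact hCB hQ.start
  rcases (Fin.one_le_of_ne_zero hi).eq_or_lt with h | h
  · rw [h]
  · have hS : Q 1 ∈ S := (hQ.range_eq.subset ⟨_, rfl⟩).2
    have h1 := hQ.ordered 0 1 (by simp)
    rw [hQ.start] at h1
    exact absurd (hQ.ordered _ _ h) (hfirst _ hS h1)

/-- If the line of `X` does not separate `b` from `d`, where `b` is on the line of `B` and `d` on
the line of `C`, then the order of `C` and `X` in the pencil of `B` and `T` is determined. -/
theorem mul_nonneg_of_pair {B T b d : Plane} {t τ : ℝ} (hBb : pair B b = 1)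
    (hCd : pair (B + τ • (B - T)) d = 1)
    (h : 0 ≤ (pair (B + t • (B - T)) b - 1) * (pair (B + t • (B - T)) d - 1)) :
    0 ≤ (pair B d - 1) * (1 - pair T b) * (τ * t * (τ - t)) := by
  simp only [pair_add_smul, pair_sub] at *
  -- For X with parameter t, pair X b - 1 = t (1 - pair T b), and eliminating pair T d by `hCd`
  -- gives τ (pair X d - 1) = (τ - t) (pair B d - 1).
  have key : (pair B d - 1) * (1 - pair T b) * (τ * t * (τ - t)) =
      τ ^ 2 * ((pair B b + t * (pair B b - pair T b) - 1) *
        (pair B d + t * (pair B d - pair T d) - 1)) := by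
    rw [hBb]
    linear_combination (-(τ * t ^ 2 * (1 - pair T b))) * hCd
  rw [key]
  positivity

/-- If C ≠ B is met before X, then τ t (τ - t) < 0 in all three cases of `MetBefore`: this product
records the cyclic order of 0, t, τ. -/
theorem not_metBefore_of_pos {S : Set Plane} {B T C b d : Plane}
    (hBb : pair B b = 1) (hCd : pair C d = 1) (hCB : C ≠ B)
    (hside : ∀ X ∈ S, 0 ≤ (pair X b - 1) * (pair X d - 1))
    (hpos : 0 < (pair B d - 1) * (1 - pair T b)) : ∀ X ∈ S, ¬ MetBefore B T C X := by
  rintro X hX ⟨τ, t, rfl, rfl, h⟩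
  have hτ : τ ≠ 0 := by rintro rfl; simp at hCB
  have h1 := nonneg_of_mul_nonneg_right (mul_nonneg_of_pair hBb hCd (hside _ hX)) hpos
  rcases h with ⟨h2, h3⟩ | ⟨h2, h3⟩ | ⟨h2, h3⟩
  · have h2 := lt_of_le_of_ne h2 hτ.symm
    have := mul_pos (mul_pos h2 (h2.trans h3)) (sub_pos.2 h3)
    linarith
  · have h2 := lt_of_le_of_ne h2 hτ.symm
    have := mul_pos (mul_pos h2 (neg_pos.2 h3)) (sub_pos.2 (h3.trans h2))
    linarith
  · have := mul_pos (mul_pos_of_neg_of_neg (h2.trans h3) h3) (sub_pos.2 h2)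
    linarith

/-- The mirror case: X met strictly between B and C would make τ t (τ - t) positive. `MetBefore B T
B X` serves to exclude X = B. -/
theorem not_metBefore_of_neg {S : Set Plane} {B T C b d : Plane} (hBT : B ≠ T)
    (hBb : pair B b = 1) (hCd : pair C d = 1)
    (hside : ∀ X ∈ S, 0 ≤ (pair X b - 1) * (pair X d - 1))
    (hneg : (pair B d - 1) * (1 - pair T b) < 0) :
    ∀ X ∈ S, MetBefore B T B X → ¬ MetBefore B T X C := by
  rintro X hX ⟨s, t', hs, hX', hst⟩ ⟨t, τ, rfl, rfl, h⟩
  obtain rfl : t = t' := add_smul_sub_injective hBT hX'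
  have ht : t ≠ 0 := by
    rintro rfl
    obtain rfl : s = 0 := add_smul_sub_injective hBT (by simpa using hs.symm)
    simp at hst
  have h1 := mul_nonneg_of_pair hBb hCd (hside _ hX)
  have h1 : τ * t * (τ - t) ≤ 0 := by
    by_contra! h2
    have := mul_neg_of_neg_of_pos hneg h2
    linarith
  rcases h with ⟨h2, h3⟩ | ⟨h2, h3⟩ | ⟨h2, h3⟩
  · have h2 := lt_of_le_of_ne h2 ht.symm
    have := mul_pos (mul_pos (h2.trans h3) h2) (sub_pos.2 h3)
    linarith
  · have h2 := lt_of_le_of_ne h2 ht.symm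
    have := mul_pos (mul_pos (neg_pos.2 h3) h2) (sub_pos.2 (h3.trans h2))
    linarith
  · have := mul_pos (mul_pos_of_neg_of_neg h3 (h2.trans h3)) (sub_pos.2 h2)
    linarith

theorem ite_side_eq_iff {x y : ℝ} (hx : x ≠ 0) (hy : y ≠ 0) :
    (if x < 0 then Side.r else Side.l) = (if y < 0 then Side.r else Side.l) ↔ 0 < x * y := by
  rcases lt_or_gt_of_ne hx with h | h <;> rcases lt_or_gt_of_ne hy with h' | h'
  · simp [h, h', mul_pos_of_neg_of_neg]
  · simp [h, h'.not_gt, (mul_neg_of_neg_of_pos h h').le]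
  · simp [h.not_gt, h', (mul_neg_of_pos_of_neg h h').le]
  · simp [h.not_gt, h'.not_gt, mul_pos h h']

/-! ### Signs along a clockwise tour -/

theorem originSide_eq_ite {n : ℕ} (V : ZMod n → Plane) (k : ZMod n) :
    originSide V k = if cross (V k) (V (k + 1)) < 0 then .r else .l := by
  rw [originSide, cross_sub_neg]

namespace IsClockwiseTour

variable {S Δ : Set Plane} {n : ℕ} {P V : ZMod n → Plane}

theorem pair_left (h : IsClockwiseTour S Δ P V) (k : ZMod n) : pair (P k) (V k) = 1 :=
  ((h.side_eq k).superset (left_mem_segment ℝ _ _)).2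

theorem pair_right (h : IsClockwiseTour S Δ P V) (k : ZMod n) : pair (P k) (V (k + 1)) = 1 :=
  ((h.side_eq k).superset (right_mem_segment ℝ _ _)).2

theorem vertex_mem_closure (h : IsClockwiseTour S Δ P V) (k : ZMod n) : V k ∈ closure Δ :=
  ((h.side_eq k).superset (left_mem_segment ℝ _ _)).1

theorem ne_succ (h : IsClockwiseTour S Δ P V) (k : ZMod n) : P k ≠ P (k + 1) :=
  -- Injectivity would give k = k + 1, hence a degenerate side.
  fun h' => h.vertex_ne k (congrArg V (h.injective h'))

theorem cross_vertex_ne_zero (h : IsClockwiseTour S Δ P V) (k : ZMod n) :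
    cross (V k) (V (k + 1)) ≠ 0 :=
  cross_ne_zero_of_pair_eq_one' (h.vertex_ne k) (h.pair_left k) (h.pair_right k)

theorem cross_sub_nonpos (h : IsClockwiseTour S Δ P V) (k : ZMod n) {x : Plane}
    (hx : x ∈ closure Δ) : cross (V (k + 1) - V k) (x - V k) ≤ 0 :=
  closure_minimal (fun x hx => (h.clockwise k x hx).le)
    (isClosed_le ((continuous_cross _).comp (continuous_sub_right _)) continuous_const) hx

/-- The points of the closed region that are not on the line of a side are on the side of it
that is given by the clockwise travel. -/
theorem pos_of_pair_ne_one (h : IsClockwiseTour S Δ P V) (k : ZMod n) {x : Plane}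
    (hx : x ∈ closure Δ) (hne : pair (P k) x ≠ 1) :
    0 < (pair (P k) x - 1) * cross (V k) (V (k + 1)) := by
  have h1 := h.cross_sub_nonpos k hx
  rw [cross_sub_sub_of_pair_eq_one (h.pair_left k) (h.pair_right k)] at h1
  exact lt_of_le_of_ne (by linarith)
    (mul_ne_zero (sub_ne_zero.2 hne) (h.cross_vertex_ne_zero k)).symm

/-- The sides on which the origin lies tell how the coefficient points turn about the origin. -/
theorem cross_mul_cross_mul_cross_neg (h : IsClockwiseTour S Δ P V) (k : ZMod n) :
    cross (P k) (P (k + 1)) *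
      (cross (V k) (V (k + 1)) * cross (V (k + 1)) (V (k + 1 + 1))) < 0 := by
  -- This becomes cross P_k P_{k+1} · cross V_k V_{k+1} = 1 - pair P_{k+1} V_k, whose sign is known
  -- because V_k lies strictly inside the next side.
  have h1 := pair_mul_pair_sub (P k) (P (k + 1)) (V k) (V (k + 1))
  rw [h.pair_left k, h.pair_right k, h.pair_left (k + 1)] at h1
  have hne : pair (P (k + 1)) (V k) ≠ 1 := fun h' => h.ne_succ k
    (eq_of_pair_eq_one (h.vertex_ne k) (h.pair_left k) (h.pair_right k) h' (h.pair_left (k + 1)))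
  have h2 := h.pos_of_pair_ne_one (k + 1) (h.vertex_mem_closure k) hne
  rw [← mul_assoc, h1]
  linarith

end IsClockwiseTour

end LinePattern

/-! ### The theorem -/

open LinePattern in
theorem theorem3p12 (S : Set Plane) (hS : S.Finite) (hO : (0 : Plane) ∉ S)
    (Δ : Set Plane) (hΔ : IsRegion S Δ) (hb : Bornology.IsBounded Δ)
    (n : ℕ) (P V : ZMod n → Plane) (hPV : IsClockwiseTour S Δ P V) (k : ZMod n) :
    (∃ (T : Plane) (q : ℕ) (Q : Fin (q + 1) → Plane),
        IsFirstHit S (P k) (P (k + 1)) (originSide V (k + 1)) T ∧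
        IsTravelList S (P (k + 1)) T Q) ∧
    ∀ (T : Plane) (q : ℕ) (Q : Fin (q + 1) → Plane),
      IsFirstHit S (P k) (P (k + 1)) (originSide V (k + 1)) T →
      IsTravelList S (P (k + 1)) T Q →
        0 < q ∧
        (originSide V k = originSide V (k + 1) → P (k + 2) = Q (Fin.last q)) ∧
        (originSide V k ≠ originSide V (k + 1) → P (k + 2) = Q 1) := by
  have hk : k + 2 = k + 1 + 1 := by rw [add_assoc, one_add_one_eq_two]
  rw [hk, originSide_eq_ite, originSide_eq_ite, Ne,
    ite_side_eq_iff (hPV.cross_vertex_ne_zero k) (hPV.cross_vertex_ne_zero (k + 1))]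
  have hAb := hPV.pair_right k
  have hBb := hPV.pair_left (k + 1)
  have hBa := hPV.pair_right (k + 1)
  have hCa := hPV.pair_left (k + 1 + 1)
  have hCd := hPV.pair_right (k + 1 + 1)
  have hAB := hPV.ne_succ k
  have hBC := hPV.ne_succ (k + 1)
  have hside : ∀ X ∈ S, ∀ i j, 0 ≤ (pair X (V i) - 1) * (pair X (V j) - 1) := fun X hX i j =>
    hΔ.pair_sub_one_mul_nonneg hX (hPV.vertex_mem_closure i) (hPV.vertex_mem_closure j)
  have hhit := fun T => isFirstHit_iff (T := T) (hPV.vertex_ne (k + 1)) hAB hBC.symm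
    (hPV.mem (k + 1 + 1)) hAb hBb hBa hCa fun X hX => hside X hX _ _
  have hx : cross (P k) (P (k + 1)) ≠ 0 := cross_ne_zero_of_pair_eq_one hAB hAb hBb
  have hy := hPV.cross_vertex_ne_zero (k + 1)
  have hBT := ne_add_smul hx (cross (P k) (P (k + 1)) * cross (V (k + 1)) (V (k + 1 + 1)))
  refine ⟨?_, ?_⟩
  · obtain ⟨q, Q, hQ⟩ := exists_isTravelList hS (hPV.mem (k + 1)) hBT
    exact ⟨_, q, Q, (hhit _).2 rfl, hQ⟩
  · rintro T q Q hT hQ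
    obtain rfl := (hhit T).1 hT
    set T := P k + (cross (P k) (P (k + 1)) * cross (V (k + 1)) (V (k + 1 + 1))) • P (k + 1)
    have hTb : pair T (V (k + 1)) =
        1 + cross (P k) (P (k + 1)) * cross (V (k + 1)) (V (k + 1 + 1)) := by
      rw [pair_add_smul, hAb, hBb, mul_one]
    have hTa : pair T (V (k + 1 + 1)) = 1 := by
      have := pair_mul_pair_sub (P k) (P (k + 1)) (V (k + 1)) (V (k + 1 + 1))
      rw [hAb, hBb, hBa] at this
      rw [pair_add_smul, hBa]
      linarith
    have hC : P (k + 1 + 1) ∈ Set.range Q := by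
      rw [hQ.range_eq]
      exact ⟨(mem_pencilLine_iff_pair hBT hBa hTa _).2 hCa, hPV.mem _⟩
    have hBd : pair (P (k + 1)) (V (k + 1 + 1 + 1)) ≠ 1 := fun h =>
      hBC (eq_of_pair_eq_one (hPV.vertex_ne (k + 1 + 1)) hBa h hCa hCd)
    have hpos := hPV.pos_of_pair_ne_one (k + 1) (hPV.vertex_mem_closure _) hBd
    have hturn := hPV.cross_mul_cross_mul_cross_neg k
    -- By `hpos` the sign of this product is opposite to that of cross A B, and `hturn` makes cross
    -- A B negative exactly when the two origin sides agree.
    have hval : (pair (P (k + 1)) (V (k + 1 + 1 + 1)) - 1) * (1 - pair T (V (k + 1))) =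
        -(cross (P k) (P (k + 1)) * ((pair (P (k + 1)) (V (k + 1 + 1 + 1)) - 1) *
          cross (V (k + 1)) (V (k + 1 + 1)))) := by
      rw [hTb]; ring
    refine ⟨hQ.pos hC hBC.symm, fun h => hQ.eq_last hC ?_, fun h => hQ.eq_one hC hBC.symm ?_⟩
    · refine not_metBefore_of_pos hBb hCd hBC.symm (fun X hX => hside X hX _ _) ?_
      rw [hval, neg_pos]
      exact mul_neg_of_neg_of_pos (neg_of_mul_neg_left hturn h.le) hpos
    · refine not_metBefore_of_neg hBT hBb hCd (fun X hX => hside X hX _ _) ?_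
      rw [hval, neg_lt_zero]
      exact mul_pos (pos_of_mul_neg_left hturn (not_lt.1 h)) hpos
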